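/- Let $\mathbb K$ be a field, let $\mathbb F_q$ be a finite field with primitive element $\alpha$, and let $\mathcal C\subseteq\mathbb F_q^n$ be a linear code. Let $\mathbb K[\mathbf x]$ be the polynomial ring in the variables $x_{ji}$ ($1\le j\le n$, $1\le i\le q-1$). For $a\in\mathbb F_q^n$ let $\blacktriangle a\in\mathbb N_0^{n(q-1)}$ be the vector whose $j$-th block of length $q-1$ is the unit vector $\mathbf e_i$ if $a_j=\alpha^i$ with $1\le i\le q-1$, and $\mathbf 0$ if $a_j=0$. The generalized code ideal of $\mathcal C$ is $$I_+(\mathcal C)=\left\langle \mathbf x^{\blacktriangle a}-\mathbf x^{\blacktriangle b}\;\middle|\; a,b\in\mathbb F_q^n,\ a-b\in\mathcal C\right\rangle\subseteq\mathbb K[\mathbf x].$$ The universal Gröbner basis $\mathcal U(I)$ of an ideal $I$ is the union of its reduced Gröbner bases $\mathcal G_\succ(I)$ over all monomial orders $\succ$. Let $u,u'\in\mathbb N_0^{n(q-1)}$ with $u,u'\neq\mathbf 0$. (1) If $\mathbf x^u-\mathbf x^{u'}\in\mathcal U(I_+(\mathcal C))$, then $\mathbf x^{u'}-\mathbf x^{u}\in\mathcal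 U(I_+(\mathcal C))$. More precisely (this makes a difference only if $\mathbb K$ has characteristic $2$, where the two binomials are equal as polynomials): if $\mathbf x^u-\mathbf x^{u'}$ is an element, with leading monomial $\mathbf x^u$, of $\mathcal G_\succ(I_+(\mathcal C))$ for some monomial order $\succ$, then $\mathbf x^{u'}-\mathbf x^{u}$ is an element, with leading monomial $\mathbf x^{u'}$, of $\mathcal G_{\succ'}(I_+(\mathcal C))$ for some monomial order $\succ'$. (2) This fails for binomial ideals in general. For $I=\langle x^2-xy,\;y^2-xy\rangle\subset\mathbb K[x,y]$, the binomial $xy-y^2$ lies, with leading monomial $xy$, in some reduced Gröbner basis of $I$, but $y^2-xy$ does not lie, with leading monomial $y^2$, in any reduced Gröbner basis of $I$. In particular, if $\mathbb K$ has characteristic different from $2$, then $xy-y^2\in\mathcal U(I)$ and $y^2-xy\notin\mathcal U(I)$. -/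

import Mathlib

open MvPolynomial
open scoped MonomialOrder

universe u v w

noncomputable section

/-- `G` is the reduced Gröbner basis of the ideal `I` with respect to the monomial order `m`:
a finite subset of `I` whose leading terms generate the leading ideal of `I`, consisting of monic
polynomials, and such that no monomial occurring in an element of `G` is divisible by the leading
monomial of another element of `G`. -/
structure IsReducedGroebnerBasis {σ : Type u} {K : Type v} [Field K] (m : MonomialOrder.{u, u} σ)
    (I : Ideal (MvPolynomial σ K)) (G : Set (MvPolynomial σ K)) : Prop where
  finite : G.Finite
  subset : G ⊆ (I : Set (MvPolynomial σ K))
  span_leadingTerm : Ideal.span (m.leadingTerm '' G) =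
    Ideal.span (m.leadingTerm '' (I : Set (MvPolynomial σ K)))
  monic : ∀ g ∈ G, m.leadingCoeff g = 1
  reduced : ∀ g ∈ G, ∀ g' ∈ G, g' ≠ g → ∀ a ∈ g.support, ¬ m.degree g' ≤ a

/-- The universal Gröbner basis of `I`: the union of the reduced Gröbner bases of `I` over all
monomial orders. (Every monomial order on `σ →₀ ℕ` is, up to equivalence, a `MonomialOrder` whose
underlying type lives in the universe of `σ`.) -/
def universalGroebnerBasis {σ : Type u} {K : Type v} [Field K] (I : Ideal (MvPolynomial σ K)) :
    Set (MvPolynomial σ K) :=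
  {f | ∃ (m : MonomialOrder.{u, u} σ) (G : Set (MvPolynomial σ K)),
    IsReducedGroebnerBasis m I G ∧ f ∈ G}

/-- The polynomial `x^a - x^b`. -/
def binom {σ : Type u} (K : Type v) [Field K] (a b : σ →₀ ℕ) : MvPolynomial σ K :=
  monomial a 1 - monomial b 1

/-- `x^a - x^b` lies, with leading monomial `x^a`, in the reduced Gröbner basis of `I` for some
monomial order. If `K` has characteristic different from two this is the same as
`x^a - x^b` being in the universal Gröbner basis; in characteristic two the polynomials
`x^a - x^b` and `x^b - x^a` coincide, and this records which of the two binomials is meant. -/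
def LiesInWithLeading {σ : Type u} {K : Type v} [Field K] (I : Ideal (MvPolynomial σ K))
    (a b : σ →₀ ℕ) : Prop :=
  ∃ (m : MonomialOrder.{u, u} σ) (G : Set (MvPolynomial σ K)),
    IsReducedGroebnerBasis m I G ∧ binom K a b ∈ G ∧ b ≺[m] a

open Classical in
/-- The crossing map for the element `α` of `F` (a primitive element, in the application): a
coordinate `c j = α ^ i` with `1 ≤ i ≤ q - 1` becomes the `i`-th unit vector of length `q - 1`, a
zero coordinate becomes the zero vector. The index `i : Fin (q - 1)` stands for the exponent
`i + 1`. -/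
def crossing {F : Type w} [Field F] [Fintype F] (α : Fˣ) {n : ℕ} (c : Fin n → F) :
    (Fin n × Fin (Fintype.card F - 1)) →₀ ℕ :=
  Finsupp.equivFunOnFinite.symm
    fun ji => if c ji.1 = (α : F) ^ ((ji.2 : ℕ) + 1) then 1 else 0

/-- The generalized code ideal of the linear code `C`, generated by all `x^(▲a) - x^(▲b)` with
`a - b` in `C`. -/
def generalizedCodeIdeal (K : Type v) [Field K] {F : Type w} [Field F] [Fintype F] (α : Fˣ)
    {n : ℕ} (C : Submodule F (Fin n → F)) :
    Ideal (MvPolynomial (Fin n × Fin (Fintype.card F - 1)) K) :=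
  Ideal.span {f | ∃ a b : Fin n → F, a - b ∈ C ∧ f = binom K (crossing α a) (crossing α b)}

/-- The ideal `⟨x² - xy, y² - xy⟩` of `K[x, y]`, where `x = X 0` and `y = X 1`. -/
def exampleIdeal (K : Type v) [Field K] : Ideal (MvPolynomial (Fin 2) K) :=
  Ideal.span {X 0 ^ 2 - X 0 * X 1, X 1 ^ 2 - X 0 * X 1}

end

/-! Call two exponents congruent when their binomial lies in `I`, and an exponent standard when it
is the smallest of its class. For an ideal generated by binomials, `x^a - x^b` with leading monomial
`x^a` occurs in a reduced basis exactly when `a` and `b` are congruent, `b` and all proper divisors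
of `a` are standard, and `b` is smaller than `a` (`not_isNonstandard_right`,
`not_isNonstandard_of_lt`, `IsBinomialIdeal.liesInWithLeading`).

A code ideal allows division by variables (`isCancellative_generalizedCodeIdeal`). Hence `u` and `v`
have disjoint supports, and `u` lies below every other class member sharing a variable with it. A
positive rational weight `w` realizes the inequalities needed
(`MonomialOrder.exists_weight_of_forall_lt`, from Gordan's alternative). Scaling it by `w u / w v`
on the variables outside the support of `u` makes `u` and `v` the only lightest members of their
class; a tie-break in favour of `u` reverses the binomial (`exists_monomialOrder_reversing`).

The example is not cancellative: `xy` is congruent to both `x²` and `y²`, one of which is smaller in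
any order, so `xy` is never standard. -/

/-- An ideal generated by a set of pure difference binomials. -/
def IsBinomialIdeal {σ : Type u} {K : Type v} [Field K] (I : Ideal (MvPolynomial σ K)) : Prop :=
  ∃ r : (σ →₀ ℕ) → (σ →₀ ℕ) → Prop, I = Ideal.span {f | ∃ a b, r a b ∧ f = binom K a b}

/-! ### The congruence of a binomial ideal -/

section Congruence

variable {σ : Type u} {K : Type v} [Field K]

theorem binom_self (a : σ →₀ ℕ) : binom K a a = 0 := sub_self _

theorem neg_binom (a b : σ →₀ ℕ) : -binom K a b = binom K b a := neg_sub _ _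

theorem binom_add_binom (a b c : σ →₀ ℕ) : binom K a b + binom K b c = binom K a c :=
  sub_add_sub_cancel _ _ _

theorem monomial_mul_binom (c a b : σ →₀ ℕ) :
    monomial c 1 * binom K a b = binom K (c + a) (c + b) := by
  simp [binom, mul_sub, monomial_mul]

theorem coeff_binom_left {a b : σ →₀ ℕ} (h : a ≠ b) : coeff a (binom K a b) = 1 := by
  classical simp [binom, coeff_monomial, h.symm]

theorem coeff_binom_right {a b : σ →₀ ℕ} (h : a ≠ b) : coeff b (binom K a b) = -1 := by
  classical simp [binom, coeff_monomial, h]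

theorem mem_support_binom {a b x : σ →₀ ℕ} (h : x ∈ (binom K a b).support) : x = a ∨ x = b := by
  classical
  by_contra! hx
  simp [binom, coeff_monomial, hx.1.symm, hx.2.symm] at h

theorem left_mem_support_binom {a b : σ →₀ ℕ} (h : a ≠ b) : a ∈ (binom K a b).support := by
  simp [mem_support_iff, coeff_binom_left h]

theorem right_mem_support_binom {a b : σ →₀ ℕ} (h : a ≠ b) : b ∈ (binom K a b).support := by
  simp [mem_support_iff, coeff_binom_right h]

/-- The congruence on exponent vectors given by the binomials in an ideal. -/
def binomCon (I : Ideal (MvPolynomial σ K)) : AddCon (σ →₀ ℕ) where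
  r a b := binom K a b ∈ I
  iseqv :=
    { refl := fun a => by rw [binom_self]; exact I.zero_mem
      symm := fun {a b} h => by rw [← neg_binom]; exact I.neg_mem h
      trans := fun {a b c} h h' => by rw [← binom_add_binom a b c]; exact I.add_mem h h' }
  add' := fun {a b c d} h h' => by
    rw [← binom_add_binom (a + c) (a + d) (b + d), ← monomial_mul_binom, add_comm a d,
      add_comm b d, ← monomial_mul_binom]
    exact I.add_mem (I.mul_mem_left _ h') (I.mul_mem_left _ h)

theorem binomCon_iff {I : Ideal (MvPolynomial σ K)} {a b : σ →₀ ℕ} :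
    binomCon I a b ↔ binom K a b ∈ I := Iff.rfl

/-- In an ideal generated by binomials that respect a congruence, no element has a monomial that
is alone in its congruence class. -/
theorem exists_mem_support_of_mem_span_binom {r : (σ →₀ ℕ) → (σ →₀ ℕ) → Prop}
    {c : AddCon (σ →₀ ℕ)} (hc : ∀ a b, r a b → c a b) {f : MvPolynomial σ K}
    (hf : f ∈ Ideal.span {f | ∃ a b, r a b ∧ f = binom K a b}) {x : σ →₀ ℕ} (hx : x ∈ f.support) :
    ∃ y ∈ f.support, y ≠ x ∧ c x y := by
  classical
  -- The map to the monoid algebra of the quotient kills every generator; its coefficient at a class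
  -- is the sum of the coefficients over that class.
  have key : Ideal.span {f | ∃ a b, r a b ∧ f = binom K a b} ≤
      RingHom.ker (AddMonoidAlgebra.mapDomainRingHom K c.mk') := by
    rw [Ideal.span_le]
    rintro _ ⟨a, b, hab, rfl⟩
    have : c.mk' a = c.mk' b := (AddCon.eq c).2 (hc a b hab)
    rw [SetLike.mem_coe, RingHom.mem_ker, binom, map_sub, sub_eq_zero]
    change AddMonoidAlgebra.mapDomain c.mk' (AddMonoidAlgebra.single a 1) =
      AddMonoidAlgebra.mapDomain c.mk' (AddMonoidAlgebra.single b 1)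
    rw [AddMonoidAlgebra.mapDomain_single, AddMonoidAlgebra.mapDomain_single, this]
  have h0 : AddMonoidAlgebra.mapDomain c.mk' f = 0 := key hf
  have h1 : Finsupp.mapDomain c.mk' (AddMonoidAlgebra.coeff f) (c.mk' x) = 0 := by
    have := congrArg (fun g => AddMonoidAlgebra.coeff g (c.mk' x)) h0
    simpa using this
  by_contra! hcon
  rw [Finsupp.mapDomain, Finsupp.sum_apply, Finsupp.sum, finsupp_support_eq_support,
    Finset.sum_eq_single x (fun y hy hyx => ?_) (fun h => absurd hx h)] at h1
  · rw [Finsupp.single_eq_same] at h1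
    exact mem_support_iff.1 hx h1
  · refine Finsupp.single_eq_of_ne fun h => hcon y hy hyx ((AddCon.eq c).1 h)

theorem con_of_binom_mem_span {r : (σ →₀ ℕ) → (σ →₀ ℕ) → Prop} {c : AddCon (σ →₀ ℕ)}
    (hc : ∀ a b, r a b → c a b) {x y : σ →₀ ℕ}
    (h : binom K x y ∈ Ideal.span {f | ∃ a b, r a b ∧ f = binom K a b}) : c x y := by
  by_cases hxy : x = y
  · subst hxy; exact c.refl x
  obtain ⟨z, hz, hzx, hc⟩ :=
    exists_mem_support_of_mem_span_binom hc h (left_mem_support_binom hxy)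
  obtain rfl := (mem_support_binom hz).resolve_left hzx
  exact hc

theorem IsBinomialIdeal.exists_mem_support {I : Ideal (MvPolynomial σ K)} (hI : IsBinomialIdeal I)
    {f : MvPolynomial σ K} (hf : f ∈ I) {x : σ →₀ ℕ} (hx : x ∈ f.support) :
    ∃ y ∈ f.support, y ≠ x ∧ binom K x y ∈ I := by
  obtain ⟨r, hr⟩ := hI
  have hc : ∀ a b, r a b → binomCon I a b := fun a b h => by
    rw [binomCon_iff, hr]
    exact Ideal.subset_span ⟨a, b, h, rfl⟩
  rw [hr] at hf
  exact exists_mem_support_of_mem_span_binom hc hf hx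

end Congruence

/-! ### Reduced Gröbner bases and standard monomials -/

section Groebner

variable {σ : Type u} {K : Type v} [Field K] {m : MonomialOrder.{u, u} σ}
  {I : Ideal (MvPolynomial σ K)}

theorem degree_binom {a b : σ →₀ ℕ} (h : b ≺[m] a) : m.degree (binom K a b) = a := by
  have hne : a ≠ b := by rintro rfl; exact lt_irrefl _ h
  apply m.toSyn.injective
  refine le_antisymm (m.degree_le_iff.2 fun x hx => ?_) (m.le_degree (left_mem_support_binom hne))
  obtain rfl | rfl := mem_support_binom hx
  · exact le_rfl
  · exact h.le

theorem leadingCoeff_binom {a b : σ →₀ ℕ} (h : b ≺[m] a) : m.leadingCoeff (binom K a b) = 1 := by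
  rw [MonomialOrder.leadingCoeff, degree_binom h]
  exact coeff_binom_left (by rintro rfl; exact lt_irrefl _ h)

theorem leadingTerm_binom {a b : σ →₀ ℕ} (h : b ≺[m] a) :
    m.leadingTerm (binom K a b) = monomial a 1 := by
  rw [MonomialOrder.leadingTerm, degree_binom h, leadingCoeff_binom h]

/-- `x` is not the smallest monomial in its class modulo `I`. -/
def IsNonstandard (m : MonomialOrder.{u, u} σ) (I : Ideal (MvPolynomial σ K)) (x : σ →₀ ℕ) : Prop :=
  ∃ y, binom K x y ∈ I ∧ y ≺[m] x

theorem IsNonstandard.mono {x y : σ →₀ ℕ} (h : IsNonstandard m I x) (hxy : x ≤ y) :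
    IsNonstandard m I y := by
  obtain ⟨z, hz, hlt⟩ := h
  obtain ⟨d, rfl⟩ := exists_add_of_le hxy
  refine ⟨z + d, (binomCon I).add hz ((binomCon I).refl d), ?_⟩
  simpa using hlt

theorem exists_normalForm (m : MonomialOrder.{u, u} σ) (I : Ideal (MvPolynomial σ K))
    (x : σ →₀ ℕ) : ∃ y, binom K x y ∈ I ∧ ¬ IsNonstandard m I y := by
  obtain ⟨y, hy, hmin⟩ := (InvImage.wf m.toSyn wellFounded_lt).has_min
    {y | binom K x y ∈ I} ⟨x, (binomCon I).refl x⟩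
  refine ⟨y, hy, ?_⟩
  rintro ⟨z, hz, hlt⟩
  exact hmin z ((binomCon I).trans hy hz) hlt

theorem IsReducedGroebnerBasis.exists_degree_le {G : Set (MvPolynomial σ K)}
    (hG : IsReducedGroebnerBasis m I G) {f : MvPolynomial σ K} (hf : f ∈ I) (h0 : f ≠ 0) :
    ∃ g ∈ G, m.degree g ≤ m.degree f := by
  classical
  have h1 : m.leadingTerm f ∈ Ideal.span ((fun s => monomial s (1 : K)) '' (m.degree '' G)) := by
    have : (fun s => monomial s (1 : K)) '' (m.degree '' G) = m.leadingTerm '' G := by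
      rw [Set.image_image]
      refine Set.image_congr fun g hg => ?_
      rw [MonomialOrder.leadingTerm, hG.monic g hg]
    rw [this, hG.span_leadingTerm]
    exact Ideal.subset_span ⟨f, hf, rfl⟩
  obtain ⟨_, ⟨g, hg, rfl⟩, hle⟩ := mem_ideal_span_monomial_image.1 h1 (m.degree f) (by
    rw [MonomialOrder.leadingTerm, mem_support_iff, coeff_monomial, if_pos rfl]
    exact m.leadingCoeff_ne_zero_iff.2 h0)
  exact ⟨g, hg, hle⟩

/-- The leading monomial of some `g` in `G` divides `x`, hence the monomial `a` of `f`; reducedness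
forces `g = f`. -/
theorem IsReducedGroebnerBasis.degree_le_of_isNonstandard {G : Set (MvPolynomial σ K)}
    (hG : IsReducedGroebnerBasis m I G) {f : MvPolynomial σ K} (hf : f ∈ G) {a x : σ →₀ ℕ}
    (ha : a ∈ f.support) (hx : IsNonstandard m I x) (hxa : x ≤ a) : m.degree f ≤ x := by
  obtain ⟨y, hy, hlt⟩ := hx
  have hne : x ≠ y := by rintro rfl; exact lt_irrefl _ hlt
  obtain ⟨g, hg, hle⟩ := hG.exists_degree_le hy
    (fun h => by simpa [h] using left_mem_support_binom (K := K) hne)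
  rw [degree_binom hlt] at hle
  by_cases hgf : g = f
  · rwa [← hgf]
  · exact absurd (hle.trans hxa) (hG.reduced f hf g hg hgf a ha)

theorem IsReducedGroebnerBasis.not_isNonstandard_right {G : Set (MvPolynomial σ K)}
    (hG : IsReducedGroebnerBasis m I G) {a b : σ →₀ ℕ} (h : binom K a b ∈ G) (hab : b ≺[m] a) :
    ¬ IsNonstandard m I b := fun hb => by
  have hne : a ≠ b := by rintro rfl; exact lt_irrefl _ hab
  have := hG.degree_le_of_isNonstandard h (right_mem_support_binom hne) hb le_rfl
  rw [degree_binom hab] at this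
  exact absurd hab (not_lt.2 (m.toSyn_monotone this))

theorem IsReducedGroebnerBasis.not_isNonstandard_of_lt {G : Set (MvPolynomial σ K)}
    (hG : IsReducedGroebnerBasis m I G) {a b : σ →₀ ℕ} (h : binom K a b ∈ G) (hab : b ≺[m] a)
    {d : σ →₀ ℕ} (hd : d < a) : ¬ IsNonstandard m I d := fun hb => by
  have hne : a ≠ b := by rintro rfl; exact lt_irrefl _ hab
  have := hG.degree_le_of_isNonstandard h (left_mem_support_binom hne) hb hd.le
  rw [degree_binom hab] at this
  exact hd.not_ge this

/-- The leading monomial of any nonzero `f` in `I` is congruent to another, hence smaller, monomial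
of `f`, so it is nonstandard and a multiple of a minimal nonstandard one. The choice `nf` is left
free so that one of its values can be prescribed. -/
theorem IsBinomialIdeal.isReducedGroebnerBasis [Finite σ] (hI : IsBinomialIdeal I)
    {nf : (σ →₀ ℕ) → (σ →₀ ℕ)}
    (hnf : ∀ x, binom K x (nf x) ∈ I ∧ ¬ IsNonstandard m I (nf x)) :
    IsReducedGroebnerBasis m I
      ((fun x => binom K x (nf x)) '' {x | Minimal (IsNonstandard m I) x}) := by
  have hlt : ∀ x, IsNonstandard m I x → nf x ≺[m] x := fun x hx => by
    refine lt_of_not_ge fun hle => ?_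
    rcases hle.lt_or_eq with h | h
    · exact (hnf x).2 ⟨x, (binomCon I).symm (hnf x).1, h⟩
    · exact (hnf x).2 (by rwa [← m.toSyn.injective h])
  have hsub : (fun x => binom K x (nf x)) '' {x | Minimal (IsNonstandard m I) x} ⊆
      (I : Set (MvPolynomial σ K)) := by
    rintro _ ⟨x, -, rfl⟩
    exact (hnf x).1
  refine ⟨?_, hsub, le_antisymm (Ideal.span_mono (Set.image_mono hsub)) ?_, ?_, ?_⟩
  · exact (WellQuasiOrderedLE.finite_of_isAntichain (setOfPred_minimal_antichain _)).image _
  · rw [Ideal.span_le]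
    rintro _ ⟨f, hf, rfl⟩
    rw [SetLike.mem_coe]
    by_cases h0 : f = 0
    · rw [h0, m.leadingTerm_zero]; exact Ideal.zero_mem _
    obtain ⟨y, hy, hyne, hyI⟩ := hI.exists_mem_support hf (m.degree_mem_support h0)
    have hns : IsNonstandard m I (m.degree f) :=
      ⟨y, hyI, lt_of_le_of_ne (m.le_degree hy) fun h => hyne (m.toSyn.injective h)⟩
    obtain ⟨x, hxle, hx⟩ :=
      (Set.isPWO_of_wellQuasiOrderedLE {x | IsNonstandard m I x}).exists_le_minimal hns
    obtain ⟨d, hd⟩ := exists_add_of_le hxle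
    have : m.leadingTerm f =
        monomial d (m.leadingCoeff f) * m.leadingTerm (binom K x (nf x)) := by
      rw [leadingTerm_binom (hlt x hx.1), monomial_mul, mul_one, MonomialOrder.leadingTerm,
        hd, add_comm]
    rw [this]
    exact Ideal.mul_mem_left _ _ (Ideal.subset_span ⟨_, ⟨x, hx, rfl⟩, rfl⟩)
  · rintro _ ⟨x, hx, rfl⟩
    exact leadingCoeff_binom (hlt x hx.1)
  · rintro _ ⟨x, hx, rfl⟩ _ ⟨x', hx', rfl⟩ hne a ha hle
    rw [degree_binom (hlt x' hx'.1)] at hle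
    rcases mem_support_binom ha with rfl | rfl
    · obtain rfl := hx.eq_of_le hx'.1 hle
      exact hne rfl
    · exact (hnf x).2 (hx'.1.mono hle)

theorem IsBinomialIdeal.liesInWithLeading [Finite σ] (hI : IsBinomialIdeal I) {a b : σ →₀ ℕ}
    (hab : binom K a b ∈ I) (hlt : b ≺[m] a) (hb : ¬ IsNonstandard m I b)
    (ha : ∀ d < a, ¬ IsNonstandard m I d) : LiesInWithLeading I a b := by
  classical
  choose nf hnf using exists_normalForm m I
  have h : ∀ x, binom K x (Function.update nf a b x) ∈ I ∧
      ¬ IsNonstandard m I (Function.update nf a b x) := fun x => by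
    by_cases hx : x = a
    · subst hx; simpa using ⟨hab, hb⟩
    · simpa [hx] using hnf x
  refine ⟨m, _, hI.isReducedGroebnerBasis h, ⟨a, ⟨⟨b, hab, hlt⟩, fun d hd hda => ?_⟩, ?_⟩, hlt⟩
  · by_contra hn
    exact ha d (lt_of_le_not_ge hda hn) hd
  · simp

end Groebner

/-! ### Gordan's alternative -/

section Gordan

/-- **Gordan's alternative** over an ordered field: finitely many vectors either lie in an open
half space or admit a nontrivial nonnegative linear relation. -/
theorem exists_dual_pos_or_exists_relation {k : Type*} [Field k] [LinearOrder k]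
    [IsStrictOrderedRing k] {ι : Type*} [DecidableEq ι] (s : Finset ι) :
    ∀ {V : Type v} [AddCommGroup V] [Module k V] (d : ι → V),
      (∃ f : V →ₗ[k] k, ∀ i ∈ s, 0 < f (d i)) ∨
        ∃ c : ι → k, (∀ i ∈ s, 0 ≤ c i) ∧ (∃ i ∈ s, c i ≠ 0) ∧ ∑ i ∈ s, c i • d i = 0 := by
  induction s using Finset.induction_on with
  | empty => intro V _ _ d; exact Or.inl ⟨0, by simp⟩
  | insert e s he ih =>
    intro V _ _ d
    have hne : ∀ i ∈ s, i ≠ e := fun i hi h => he (h ▸ hi)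
    have hupd : ∀ (c : ι → k) (r : k),
        ∑ i ∈ s, Function.update c e r i • d i = ∑ i ∈ s, c i • d i := fun c r =>
      Finset.sum_congr rfl fun i hi => by rw [Function.update_of_ne (hne i hi)]
    have hnonneg : ∀ (c : ι → k) (r : k), (∀ i ∈ s, 0 ≤ c i) → 0 ≤ r →
        ∀ i ∈ insert e s, 0 ≤ Function.update c e r i := fun c r hc hr i hi => by
      rcases Finset.mem_insert.1 hi with rfl | hi
      · simpa using hr
      · rw [Function.update_of_ne (hne i hi)]; exact hc i hi
    rcases ih d with ⟨f, hf⟩ | ⟨c, hc, ⟨i, hi, hci⟩, hsum⟩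
    swap
    · refine Or.inr ⟨Function.update c e 0, hnonneg c 0 hc le_rfl,
        ⟨i, Finset.mem_insert_of_mem hi, by rwa [Function.update_of_ne (hne i hi)]⟩, ?_⟩
      rw [Finset.sum_insert he, hupd, hsum]
      simp
    rcases lt_or_ge 0 (f (d e)) with hpos | hfe
    · refine Or.inl ⟨f, fun i hi => ?_⟩
      rcases Finset.mem_insert.1 hi with rfl | hi
      · exact hpos
      · exact hf i hi
    by_cases hde : d e = 0
    · refine Or.inr ⟨Function.update 0 e 1, hnonneg 0 1 (fun _ _ => le_rfl) zero_le_one,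
        ⟨e, Finset.mem_insert_self _ _, by simp⟩, ?_⟩
      rw [Finset.sum_insert he, hupd]
      simp [hde]
    -- Here `f` is positive on `s` but not on `d e ≠ 0`, so the induction hypothesis is applied
    -- modulo the line through `d e`.
    rcases ih (fun i => (Submodule.span k {d e}).mkQ (d i)) with
      ⟨g, hg⟩ | ⟨c, hc, ⟨i, hi, hci⟩, hsum⟩
    · obtain ⟨h, hh⟩ : ∃ h : V →ₗ[k] k, h (d e) ≠ 0 := by
        by_contra! hcon
        exact hde ((Module.forall_dual_apply_eq_zero_iff k _).1 hcon)
      let h' : V →ₗ[k] k := (h (d e))⁻¹ • h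
      have hh' : h' (d e) = 1 := by simp [h', hh]
      let q := (Submodule.span k {d e}).mkQ
      have hqe : q (d e) = 0 := by simp [q]
      -- Large enough for `M • g ∘ q` to outweigh `h'` on `s`; on `d e` it vanishes and `h'` is 1.
      let M : k := 1 + ∑ i ∈ s, |h' (d i)| / g (q (d i))
      refine Or.inl ⟨M • g.comp q + h', fun i hi => ?_⟩
      rcases Finset.mem_insert.1 hi with rfl | hi
      · simp [hqe, hh']
      · have hgi : 0 < g (q (d i)) := hg i hi
        have hM : |h' (d i)| / g (q (d i)) < M := by
          refine lt_of_le_of_lt ?_ (lt_one_add _)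
          exact Finset.single_le_sum (f := fun i => |h' (d i)| / g (q (d i)))
            (fun j hj => div_nonneg (abs_nonneg _) (hg j hj).le) hi
        rw [div_lt_iff₀ hgi] at hM
        have := neg_abs_le (h' (d i))
        simp only [LinearMap.add_apply, LinearMap.smul_apply, LinearMap.comp_apply, smul_eq_mul]
        linarith
    · have hmem : ∑ i ∈ s, c i • d i ∈ Submodule.span k {d e} := by
        rw [← Submodule.Quotient.mk_eq_zero, ← Submodule.mkQ_apply, map_sum, ← hsum]
        simp
      obtain ⟨r, hr⟩ := Submodule.mem_span_singleton.1 hmem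
      have hfsum : r * f (d e) = ∑ i ∈ s, c i * f (d i) := by
        simpa using congrArg f hr
      have hpos : 0 < ∑ i ∈ s, c i * f (d i) :=
        Finset.sum_pos' (fun j hj => mul_nonneg (hc j hj) (hf j hj).le)
          ⟨i, hi, mul_pos (lt_of_le_of_ne (hc i hi) hci.symm) (hf i hi)⟩
      -- Applying `f` to the lifted relation fixes the sign of `r`, so `-r` is an admissible
      -- coefficient for `d e`.
      have hr0 : r ≤ 0 := by
        by_contra! h
        exact absurd (hfsum ▸ hpos) (not_lt.2 (mul_nonpos_of_nonneg_of_nonpos h.le hfe))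
      refine Or.inr ⟨Function.update c e (-r), hnonneg c (-r) hc (neg_nonneg.2 hr0),
        ⟨i, Finset.mem_insert_of_mem hi, by rwa [Function.update_of_ne (hne i hi)]⟩, ?_⟩
      rw [Finset.sum_insert he, hupd, ← hr]
      simp

end Gordan

/-! ### Monomial orders and weights -/

section Weights

variable {σ : Type u}

/-- Finitely many strict inequalities of a monomial order are realized by a positive rational
weight. -/
theorem MonomialOrder.exists_weight [Finite σ] (m : MonomialOrder.{u, u} σ)
    (P : Finset ((σ →₀ ℕ) × (σ →₀ ℕ))) (hP : ∀ p ∈ P, p.1 ≺[m] p.2) :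
    ∃ w : (σ →₀ ℕ) →+ ℚ, (∀ x, x ≠ 0 → 0 < w x) ∧ ∀ p ∈ P, w p.1 < w p.2 := by
  classical
  have := Fintype.ofFinite σ
  -- The added pairs `0 ≺ e_i` force the weight to be positive.
  let Q := P ∪ Finset.univ.image fun i : σ => ((0 : σ →₀ ℕ), Finsupp.single i 1)
  have hQ : ∀ p ∈ Q, p.1 ≺[m] p.2 := fun p hp => by
    rcases Finset.mem_union.1 hp with hp | hp
    · exact hP p hp
    · obtain ⟨i, -, rfl⟩ := Finset.mem_image.1 hp
      exact m.toSyn_strictMono (by simp [pos_iff_ne_zero])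
  let cast : (σ →₀ ℕ) →+ (σ → ℚ) :=
    { toFun := fun x i => (x i : ℚ)
      map_zero' := by ext; simp
      map_add' := fun x y => by ext; simp }
  rcases exists_dual_pos_or_exists_relation Q (k := ℚ) (fun p => cast p.2 - cast p.1) with
    ⟨f, hf⟩ | ⟨c, hc, ⟨p, hp, hcp⟩, hsum⟩
  · let w : (σ →₀ ℕ) →+ ℚ := f.toAddMonoidHom.comp cast
    have hw : ∀ p ∈ Q, w p.1 < w p.2 := fun p hp => by
      have := hf p hp
      rw [map_sub] at this
      exact sub_pos.1 this
    have hsingle : ∀ i, 0 < w (Finsupp.single i 1) := fun i => by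
      simpa using hw (0, Finsupp.single i 1)
        (Finset.mem_union_right _ (Finset.mem_image_of_mem _ (Finset.mem_univ i)))
    have hnonneg : ∀ x, 0 ≤ w x := fun x => by
      induction x using Finsupp.induction_linear with
      | zero => simp
      | add x y hx hy => rw [map_add]; exact add_nonneg hx hy
      | single i n =>
        rw [← mul_one n, ← smul_eq_mul, ← Finsupp.smul_single, map_nsmul]
        exact nsmul_nonneg (hsingle i).le n
    refine ⟨w, fun x hx => ?_, fun p hp => hw p (Finset.mem_union_left _ hp)⟩
    obtain ⟨i, hi⟩ := Finsupp.ne_iff.1 hx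
    obtain ⟨y, rfl⟩ := exists_add_of_le (Finsupp.single_le_iff.2 (Nat.one_le_iff_ne_zero.2 hi))
    rw [map_add]
    exact add_pos_of_pos_of_nonneg (hsingle i) (hnonneg y)
  · exfalso
    -- Clearing denominators turns the relation into an equality of sums in `σ →₀ ℕ`, which
    -- contradicts adding up the strict inequalities.
    obtain ⟨b, hb⟩ := IsLocalization.exist_integer_multiples (nonZeroDivisors ℤ) Q c
    have hb0 : ((b : ℤ) : ℚ) ≠ 0 := by exact_mod_cast nonZeroDivisors.coe_ne_zero b
    have hex : ∀ p ∈ Q, ∃ n : ℕ, (n : ℚ) = |((b : ℤ) : ℚ)| * c p := fun p hp => by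
      obtain ⟨z, hz⟩ := hb p hp
      refine ⟨z.natAbs, ?_⟩
      have hz' : (z : ℚ) = (b : ℤ) * c p := by simpa using hz
      rw [Nat.cast_natAbs, Int.cast_abs, hz', abs_mul, abs_of_nonneg (hc p hp)]
    choose! n hn using hex
    have heq : ∑ p ∈ Q, n p • p.2 = ∑ p ∈ Q, n p • p.1 := by
      have : cast (∑ p ∈ Q, n p • p.2) = cast (∑ p ∈ Q, n p • p.1) := by
        rw [← sub_eq_zero, map_sum, map_sum, ← Finset.sum_sub_distrib,
          ← smul_zero |((b : ℤ) : ℚ)|, ← hsum, Finset.smul_sum]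
        refine Finset.sum_congr rfl fun p hp => ?_
        rw [map_nsmul, map_nsmul, ← smul_sub, smul_smul, ← hn p hp, Nat.cast_smul_eq_nsmul]
      ext i
      exact Nat.cast_injective (R := ℚ) (congrFun this i)
    have hlt : ∑ p ∈ Q, n p • m.toSyn p.1 < ∑ p ∈ Q, n p • m.toSyn p.2 := by
      refine Finset.sum_lt_sum (fun q hq => nsmul_le_nsmul_right (hQ q hq).le _)
        ⟨p, hp, nsmul_lt_nsmul_right ?_ (hQ p hp)⟩
      intro h0
      have := hn p hp
      rw [h0, Nat.cast_zero, eq_comm, mul_eq_zero, abs_eq_zero] at this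
      exact this.elim hb0 hcp
    have := congrArg m.toSyn heq
    simp only [map_sum, map_nsmul] at this
    exact absurd this hlt.ne'

/-- A monomial order from an injective additive map to a linearly ordered monoid that is monotone
for divisibility. -/
noncomputable def MonomialOrder.ofKey [Finite σ] {M : Type*} [AddCommMonoid M] [LinearOrder M]
    [IsOrderedAddMonoid M] (key : (σ →₀ ℕ) →+ M) (hinj : Function.Injective key)
    (hmono : Monotone key) : MonomialOrder.{u, u} σ where
  syn := σ →₀ ℕ
  addCommMonoidSyn := inferInstance
  linearOrderSyn := LinearOrder.lift' key hinj
  isOrderedAddMonoid_syn :=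
    @IsOrderedAddMonoid.mk (σ →₀ ℕ) _ (LinearOrder.lift' key hinj).toPreorder
      (fun x y (hxy : key x ≤ key y) z => by
        change key (x + z) ≤ key (y + z)
        rw [map_add, map_add]
        gcongr)
      (fun x y (hxy : key x ≤ key y) z => by
        change key (z + x) ≤ key (z + y)
        rw [map_add, map_add]
        gcongr)
  toSyn := AddEquiv.refl _
  toSyn_monotone := hmono
  wellFoundedLT_syn := ⟨by
    -- By Dickson's lemma, a strictly descending sequence would contain a term dividing a later one.
    rw [RelEmbedding.wellFounded_iff_isEmpty]
    refine ⟨fun f => ?_⟩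
    obtain ⟨i, j, hij, h⟩ := wellQuasiOrdered_le (α := σ →₀ ℕ) f
    have h1 : key (f j) < key (f i) := f.map_rel_iff.2 hij
    exact h1.not_ge (hmono h)⟩

/-- The monomial order comparing first by a nonnegative weight, then by a given monomial order. -/
noncomputable def MonomialOrder.refineWeight [Finite σ] (m : MonomialOrder.{u, u} σ)
    (w : (σ →₀ ℕ) →+ ℚ) (hw : ∀ x, 0 ≤ w x) : MonomialOrder.{u, u} σ :=
  MonomialOrder.ofKey (M := ℚ ×ₗ m.syn)
    { toFun := fun x => toLex (w x, m.toSyn x)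
      map_zero' := by rw [map_zero, map_zero]; rfl
      map_add' := fun x y => by rw [map_add, map_add]; rfl }
    (fun _ _ h => m.toSyn.injective (congrArg (fun p => (ofLex p).2) h))
    (fun x y hxy => by
      obtain ⟨z, rfl⟩ := exists_add_of_le hxy
      rw [Prod.Lex.le_iff]
      change w x < w (x + z) ∨ w x = w (x + z) ∧ m.toSyn x ≤ m.toSyn (x + z)
      rw [map_add, map_add]
      rcases (hw z).eq_or_lt with h | h
      · exact Or.inr ⟨by rw [← h, add_zero], m.le_add_right x z⟩
      · exact Or.inl (lt_add_of_pos_right _ h))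

theorem MonomialOrder.refineWeight_lt_iff [Finite σ] (m : MonomialOrder.{u, u} σ)
    (w : (σ →₀ ℕ) →+ ℚ) (hw : ∀ x, 0 ≤ w x) {x y : σ →₀ ℕ} :
    x ≺[m.refineWeight w hw] y ↔ w x < w y ∨ w x = w y ∧ x ≺[m] y :=
  Prod.Lex.lt_iff (x := toLex (w x, m.toSyn x)) (y := toLex (w y, m.toSyn y))

end Weights

/-! ### Reversing a binomial -/

section Reversal

variable {σ : Type u} {K : Type v} [Field K]

/-- Strict inequalities of a monomial order between a fixed exponent and all members of a set are
realized, for finitely many such conditions, by a positive rational weight. -/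
theorem MonomialOrder.exists_weight_of_forall_lt [Finite σ] (m : MonomialOrder.{u, u} σ)
    {u v : σ →₀ ℕ} {S T : Set (σ →₀ ℕ)} (hS : ∀ x ∈ S, u ≺[m] x) (hT : ∀ x ∈ T, v ≺[m] x) :
    ∃ w : (σ →₀ ℕ) →+ ℚ, (∀ x, x ≠ 0 → 0 < w x) ∧ (∀ x ∈ S, w u < w x) ∧ ∀ x ∈ T, w v < w x := by
  classical
  -- By Dickson's lemma each set has finitely many minimal elements, and these suffice since a
  -- nonnegative weight is monotone.
  have hfin : ∀ R : Set (σ →₀ ℕ), {x | Minimal (· ∈ R) x}.Finite := fun R =>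
    WellQuasiOrderedLE.finite_of_isAntichain (setOfPred_minimal_antichain _)
  obtain ⟨w, hpos, hw⟩ := m.exists_weight
    ((hfin S).toFinset.image (fun x => (u, x)) ∪ (hfin T).toFinset.image (fun x => (v, x))) (by
      intro p hp
      simp only [Finset.mem_union, Finset.mem_image, Set.Finite.mem_toFinset] at hp
      rcases hp with ⟨x, hx, rfl⟩ | ⟨x, hx, rfl⟩
      · exact hS x hx.1
      · exact hT x hx.1)
  have hnonneg : ∀ x, 0 ≤ w x := fun x => by
    by_cases hx : x = 0
    · rw [hx, map_zero]
    · exact (hpos x hx).le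
  have hmono : Monotone w := fun x y hxy => by
    obtain ⟨z, rfl⟩ := exists_add_of_le hxy
    rw [map_add]
    exact le_add_of_nonneg_right (hnonneg z)
  refine ⟨w, hpos, fun x hx => ?_, fun x hx => ?_⟩
  · obtain ⟨b, hbx, hb⟩ := (Set.isPWO_of_wellQuasiOrderedLE S).exists_le_minimal hx
    exact (hw (u, b) (Finset.mem_union_left _ (Finset.mem_image_of_mem _
      ((hfin S).mem_toFinset.2 hb)))).trans_le (hmono hbx)
  · obtain ⟨b, hbx, hb⟩ := (Set.isPWO_of_wellQuasiOrderedLE T).exists_le_minimal hx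
    exact (hw (v, b) (Finset.mem_union_right _ (Finset.mem_image_of_mem _
      ((hfin T).mem_toFinset.2 hb)))).trans_le (hmono hbx)

/-- Binomials in `I` can be divided by monomials. -/
def IsCancellative (I : Ideal (MvPolynomial σ K)) : Prop :=
  ∀ (k : σ) (x y : σ →₀ ℕ),
    binom K (x + Finsupp.single k 1) (y + Finsupp.single k 1) ∈ I → binom K x y ∈ I

theorem lt_of_not_isNonstandard {m : MonomialOrder.{u, u} σ} {I : Ideal (MvPolynomial σ K)}
    {x y : σ →₀ ℕ} (hx : ¬ IsNonstandard m I x) (hxy : binom K x y ∈ I) (hne : y ≠ x) :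
    x ≺[m] y := by
  by_contra! h
  exact hx ⟨y, hxy, lt_of_le_of_ne h fun h => hne (m.toSyn.injective h)⟩

theorem exists_eq_add_single {x : σ →₀ ℕ} {k : σ} (h : x k ≠ 0) :
    ∃ y, x = y + Finsupp.single k 1 := by
  obtain ⟨y, rfl⟩ := exists_add_of_le (Finsupp.single_le_iff.2 (Nat.one_le_iff_ne_zero.2 h))
  exact ⟨y, add_comm _ _⟩

theorem lt_add_single (y : σ →₀ ℕ) (k : σ) : y < y + Finsupp.single k 1 :=
  lt_add_of_pos_right _ (by simp [pos_iff_ne_zero])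

/-- A binomial of a reduced Gröbner basis of a cancellative ideal can be reversed: the weight
realizing `m` is rescaled outside the support of `u` until it no longer separates `u` from `v`, and
the tie is broken in favour of `u`. -/
theorem exists_monomialOrder_reversing [Finite σ] {I : Ideal (MvPolynomial σ K)}
    (hI : IsCancellative I) {m : MonomialOrder.{u, u} σ} {u v : σ →₀ ℕ} (hv0 : v ≠ 0)
    (huv : binom K u v ∈ I) (hlt : v ≺[m] u) (hv : ¬ IsNonstandard m I v)
    (hu : ∀ d < u, ¬ IsNonstandard m I d) :
    ∃ m' : MonomialOrder.{u, u} σ, u ≺[m'] v ∧ ¬ IsNonstandard m' I u ∧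
      ∀ d < v, ¬ IsNonstandard m' I d := by
  classical
  -- A common variable could be cancelled, making a proper divisor of `u` nonstandard.
  have hdisj : ∀ k, u k ≠ 0 → v k = 0 := fun k hk => by
    by_contra hvk
    obtain ⟨u', rfl⟩ := exists_eq_add_single hk
    obtain ⟨v', rfl⟩ := exists_eq_add_single hvk
    exact hu u' (lt_add_single _ _) ⟨v', hI k _ _ huv, by simpa using hlt⟩
  let S : Set (σ →₀ ℕ) := {x | binom K u x ∈ I ∧ x ≠ u ∧ ∃ k, u k ≠ 0 ∧ x k ≠ 0}
  let T : Set (σ →₀ ℕ) := {x | binom K v x ∈ I ∧ x ≠ v}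
  obtain ⟨w, hpos, hS, hT⟩ := m.exists_weight_of_forall_lt (u := u) (v := v) (S := S) (T := T)
    -- Cancelling the shared variable leaves a proper divisor of `u`, which is standard.
    (by
      rintro x ⟨hx, hne, k, huk, hxk⟩
      obtain ⟨u', rfl⟩ := exists_eq_add_single huk
      obtain ⟨x', rfl⟩ := exists_eq_add_single hxk
      have := lt_of_not_isNonstandard (hu u' (lt_add_single _ _)) (hI k _ _ hx)
        (fun h => hne (by rw [h]))
      simpa using this)
    (fun x hx => lt_of_not_isNonstandard hv hx.1 hx.2)
  have hnonneg : ∀ x, 0 ≤ w x := fun x => by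
    by_cases hx : x = 0
    · rw [hx, map_zero]
    · exact (hpos x hx).le
  have hvu : w v < w u := hT u ⟨(binomCon I).symm huv, by rintro rfl; exact lt_irrefl _ hlt⟩
  have hwv : 0 < w v := hpos v hv0
  let p : (σ →₀ ℕ) →+ (σ →₀ ℕ) := Finsupp.filterAddHom (fun k => u k ≠ 0)
  let q : (σ →₀ ℕ) →+ (σ →₀ ℕ) := Finsupp.filterAddHom (fun k => ¬ u k ≠ 0)
  have hpq : ∀ x, p x + q x = x := fun x => Finsupp.filter_add_filter_not x _
  let t : ℚ := w u / w v
  have ht : 1 < t := (one_lt_div hwv).2 hvu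
  have htv : t * w v = w u := div_mul_cancel₀ _ hwv.ne'
  -- `w₁` keeps `w` on the support of `u` and scales it by `t` elsewhere, so that `w₁ u = w₁ v`;
  -- `w₂` breaks the tie, as it vanishes at `u` but not at `v`.
  let w₁ : (σ →₀ ℕ) →+ ℚ := w.comp p + (AddMonoidHom.mulLeft t).comp (w.comp q)
  let w₂ : (σ →₀ ℕ) →+ ℚ := w.comp q
  have hw₁ : ∀ x, w₁ x = w (p x) + t * w (q x) := fun x => rfl
  have hw₂ : ∀ x, w₂ x = w (q x) := fun x => rfl
  have hpu : p u = u := Finsupp.filter_eq_self_iff _ _ |>.2 fun k hk => hk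
  have hqu : q u = 0 := by simpa [hpu] using hpq u
  have hpx : ∀ x : σ →₀ ℕ, (¬ ∃ k, u k ≠ 0 ∧ x k ≠ 0) → p x = 0 := fun x hx =>
    Finsupp.filter_eq_zero_iff _ _ |>.2 fun k hk => by
      by_contra h
      exact hx ⟨k, hk, h⟩
  have hpv : p v = 0 := hpx v fun ⟨k, hk, hk'⟩ => hk' (hdisj k hk)
  have hqx : ∀ x, p x = 0 → q x = x := fun x hx => by simpa [hx] using hpq x
  have hle : ∀ x, w x ≤ w₁ x := fun x => by
    rw [hw₁]
    conv_lhs => rw [← hpq x, map_add]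
    gcongr
    exact le_mul_of_one_le_left (hnonneg _) ht.le
  have hw₁u : w₁ u = w u := by rw [hw₁, hpu, hqu]; simp
  have hw₁v : w₁ v = w u := by rw [hw₁, hpv, hqx v hpv]; simp [htv]
  have hw₁S : ∀ x ∈ S, w u < w₁ x := fun x hx => (hS x hx).trans_le (hle x)
  have hw₁T : ∀ x, binom K v x ∈ I → x ≠ v → p x = 0 → w u < w₁ x := fun x hx hne hp => by
    rw [hw₁, hqx x hp, hp, map_zero, zero_add, ← htv]
    exact mul_lt_mul_of_pos_left (hT x ⟨hx, hne⟩) (zero_lt_one.trans ht)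
  let m' := (m.refineWeight w₂ fun x => hnonneg _).refineWeight w₁ fun x => (hnonneg x).trans (hle x)
  have hm' : ∀ x y, x ≺[m'] y ↔ w₁ x < w₁ y ∨ w₁ x = w₁ y ∧ (w₂ x < w₂ y ∨ w₂ x = w₂ y ∧ x ≺[m] y) :=
    fun x y => by rw [MonomialOrder.refineWeight_lt_iff, MonomialOrder.refineWeight_lt_iff]
  have huv' : u ≺[m'] v := by
    rw [hm', hw₁u, hw₁v, hw₂, hw₂, hqu, hqx v hpv, map_zero]
    exact Or.inr ⟨rfl, Or.inl hwv⟩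
  refine ⟨m', huv', ?_, ?_⟩
  · rintro ⟨x, hx, hxu⟩
    refine lt_asymm hxu ?_
    have hne : x ≠ u := by rintro rfl; exact lt_irrefl _ hxu
    by_cases hk : ∃ k, u k ≠ 0 ∧ x k ≠ 0
    · rw [hm', hw₁u]
      exact Or.inl (hw₁S x ⟨hx, hne, hk⟩)
    · by_cases hxv : x = v
      · rwa [hxv]
      · rw [hm', hw₁u]
        exact Or.inl (hw₁T x ((binomCon I).trans ((binomCon I).symm huv) hx) hxv (hpx x hk))
  -- With `v = d + e`, the exponent `x + e` would be a class member below `v`. It is not `u`, since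
  -- `e` involves a variable of `v`; every class member other than `u` and `v` is heavier.
  · rintro d hd ⟨x, hx, hxd⟩
    obtain ⟨k, hk⟩ : ∃ k, d k < v k := by
      by_contra! h
      exact hd.not_ge (Finsupp.le_def.2 h)
    obtain ⟨e, rfl⟩ := exists_add_of_le hd.le
    have hek : e k ≠ 0 := by
      have : d k < d k + e k := hk
      omega
    have hxv : x + e ≺[m'] d + e := by simpa using hxd
    have hxI : binom K (d + e) (x + e) ∈ I := (binomCon I).add hx ((binomCon I).refl e)
    have hne : x + e ≠ d + e := fun h => lt_irrefl _ (h ▸ hxv)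
    have huk : u k = 0 := by
      by_contra h
      have : d k + e k = 0 := hdisj k h
      omega
    refine lt_asymm hxv ?_
    rw [hm', hw₁v]
    by_cases hk : ∃ k, u k ≠ 0 ∧ (x + e) k ≠ 0
    · refine Or.inl (hw₁S _ ⟨(binomCon I).trans huv hxI, fun h => hek ?_, hk⟩)
      have : x k + e k = 0 := by rw [← huk, ← h]; rfl
      omega
    · exact Or.inl (hw₁T _ hxI hne (hpx _ hk))

theorem LiesInWithLeading.symm_of_isCancellative [Finite σ] {I : Ideal (MvPolynomial σ K)}
    (hI : IsBinomialIdeal I) (hc : IsCancellative I) {a b : σ →₀ ℕ} (hb : b ≠ 0)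
    (h : LiesInWithLeading I a b) : LiesInWithLeading I b a := by
  obtain ⟨m, G, hG, hmem, hlt⟩ := h
  have hab : binom K a b ∈ I := hG.subset hmem
  obtain ⟨m', hlt', ha', hb'⟩ := exists_monomialOrder_reversing hc hb hab hlt
    (hG.not_isNonstandard_right hmem hlt) fun d hd => hG.not_isNonstandard_of_lt hmem hlt hd
  exact hI.liesInWithLeading ((binomCon I).symm hab) hlt' ha' hb'

theorem LiesInWithLeading.mem_universalGroebnerBasis {I : Ideal (MvPolynomial σ K)}
    {a b : σ →₀ ℕ} (h : LiesInWithLeading I a b) : binom K a b ∈ universalGroebnerBasis I := by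
  obtain ⟨m, G, hG, hmem, -⟩ := h
  exact ⟨m, G, hG, hmem⟩

/-- A binomial in the universal Gröbner basis has the first monomial as its leading one, unless
the characteristic is two. -/
theorem liesInWithLeading_or_two_eq_zero {I : Ideal (MvPolynomial σ K)}
    {a b : σ →₀ ℕ} (h : binom K a b ∈ universalGroebnerBasis I) :
    LiesInWithLeading I a b ∨ (2 : K) = 0 := by
  obtain ⟨m, G, hG, hmem⟩ := h
  have h1 := hG.monic _ hmem
  rcases lt_trichotomy (m.toSyn b) (m.toSyn a) with hlt | heq | hlt
  · exact Or.inl ⟨m, G, hG, hmem, hlt⟩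
  · rw [m.toSyn.injective heq, binom_self, m.leadingCoeff_zero] at h1
    exact absurd h1 zero_ne_one
  -- With `x^b` leading, the leading coefficient is -1, which monicity equates with 1.
  · right
    rw [MonomialOrder.leadingCoeff, ← neg_binom, MonomialOrder.degree_neg, degree_binom hlt,
      coeff_neg, coeff_binom_left (by rintro rfl; exact lt_irrefl _ hlt)] at h1
    linear_combination -h1

theorem binom_comm_of_two_eq_zero (h : (2 : K) = 0) (a b : σ →₀ ℕ) : binom K a b = binom K b a := by
  have h2 : (2 : MvPolynomial σ K) = 0 := by rw [← map_ofNat C 2, h, map_zero]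
  rw [binom, binom]
  linear_combination (monomial a 1 - monomial b 1) * h2

end Reversal

/-! ### Cancellation in code ideals -/

section CodeIdeal

variable {K : Type v} [Field K] {F : Type w} [Field F] [Fintype F] {α : Fˣ} {n : ℕ}
  {C : Submodule F (Fin n → F)}

theorem crossing_apply (c : Fin n → F) (j : Fin n) (i : Fin (Fintype.card F - 1))
    [Decidable (c j = (α : F) ^ ((i : ℕ) + 1))] :
    crossing α c (j, i) = if c j = (α : F) ^ ((i : ℕ) + 1) then 1 else 0 := by
  simp only [crossing, Finsupp.equivFunOnFinite_symm_apply_apply]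
  congr

theorem crossing_zero : crossing α (0 : Fin n → F) = 0 := by
  classical
  ext ⟨j, i⟩
  rw [crossing_apply, if_neg]
  · rfl
  · simpa using (pow_ne_zero _ α.ne_zero).symm

theorem filter_crossing (c : Fin n → F) (j : Fin n) :
    (crossing α c).filter (fun k => k.1 ≠ j) = crossing α (Function.update c j 0) := by
  classical
  ext ⟨j', i⟩
  rw [Finsupp.filter_apply, crossing_apply, crossing_apply]
  by_cases h : j' = j
  · subst h
    simp [(pow_ne_zero _ α.ne_zero).symm]
  · simp [h]

theorem isBinomialIdeal_generalizedCodeIdeal : IsBinomialIdeal (generalizedCodeIdeal K α C) := by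
  refine ⟨fun x y => ∃ a b : Fin n → F, a - b ∈ C ∧ x = crossing α a ∧ y = crossing α b, ?_⟩
  rw [generalizedCodeIdeal]
  congr 1
  ext f
  constructor
  · rintro ⟨a, b, h, rfl⟩
    exact ⟨_, _, ⟨a, b, h, rfl, rfl⟩, rfl⟩
  · rintro ⟨_, _, ⟨a, b, h, rfl, rfl⟩, rfl⟩
    exact ⟨a, b, h, rfl⟩

theorem binom_crossing_mem {a b : Fin n → F} (h : a - b ∈ C) :
    binom K (crossing α a) (crossing α b) ∈ generalizedCodeIdeal K α C :=
  Ideal.subset_span ⟨a, b, h, rfl⟩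

theorem con_of_binom_mem_generalizedCodeIdeal
    {c : AddCon ((Fin n × Fin (Fintype.card F - 1)) →₀ ℕ)}
    (hc : ∀ a b : Fin n → F, a - b ∈ C → c (crossing α a) (crossing α b))
    {x y : (Fin n × Fin (Fintype.card F - 1)) →₀ ℕ}
    (h : binom K x y ∈ generalizedCodeIdeal K α C) : c x y := by
  obtain ⟨r, hr⟩ : ∃ r, r = fun x y =>
    ∃ a b : Fin n → F, a - b ∈ C ∧ x = crossing α a ∧ y = crossing α b := ⟨_, rfl⟩
  refine con_of_binom_mem_span (K := K) (r := r) ?_ (Ideal.span_mono ?_ h)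
  · rw [hr]
    rintro _ _ ⟨a, b, hab, rfl, rfl⟩
    exact hc a b hab
  · rw [hr]
    rintro _ ⟨a, b, hab, rfl⟩
    exact ⟨_, _, ⟨a, b, hab, rfl, rfl⟩, rfl⟩

/-- Exponents of the variables of block `j` agree, and the remaining parts are congruent
modulo `I`. -/
def blockCon {ι : Type*} (I : Ideal (MvPolynomial (Fin n × ι) K)) (j : Fin n) :
    AddCon ((Fin n × ι) →₀ ℕ) where
  r x y := x.filter (fun k => k.1 = j) = y.filter (fun k => k.1 = j) ∧
    binomCon I (x.filter fun k => k.1 ≠ j) (y.filter fun k => k.1 ≠ j)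
  iseqv :=
    { refl := fun x => ⟨rfl, (binomCon I).refl _⟩
      symm := fun h => ⟨h.1.symm, (binomCon I).symm h.2⟩
      trans := fun h h' => ⟨h.1.trans h'.1, (binomCon I).trans h.2 h'.2⟩ }
  add' := fun h h' => by
    simp only [Finsupp.filter_add]
    exact ⟨by rw [h.1, h'.1], (binomCon I).add h.2 h'.2⟩

/-- If some codeword is nonzero at `j`, a multiple `c'` of it takes the value `α ^ (i + 1)` there;
then `x^(▲c') - 1` lies in the ideal and the variable `(j, i)` is invertible modulo it. Otherwise
congruent exponents agree on block `j`, as `blockCon` contains the generators, and the variable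
cancels inside that block. -/
theorem isCancellative_generalizedCodeIdeal : IsCancellative (generalizedCodeIdeal K α C) := by
  classical
  rintro ⟨j, i⟩ x y h
  let I := generalizedCodeIdeal K α C
  by_cases hj : ∃ c ∈ C, c j ≠ 0
  · obtain ⟨c, hcC, hcj⟩ := hj
    let c' : Fin n → F := ((α : F) ^ ((i : ℕ) + 1) / c j) • c
    have hc' : c' ∈ C := C.smul_mem _ hcC
    have hc'j : c' j = (α : F) ^ ((i : ℕ) + 1) := by simp [c', hcj]
    have hinv : binomCon I (crossing α c') 0 := by
      have := binom_crossing_mem (K := K) (α := α) (a := c') (b := 0) (by simpa using hc')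
      rwa [crossing_zero] at this
    obtain ⟨d, hd⟩ := exists_eq_add_single (x := crossing α c') (k := (j, i))
      (by rw [crossing_apply, if_pos hc'j]; exact one_ne_zero)
    rw [hd] at hinv
    have key : ∀ z, binomCon I (z + Finsupp.single (j, i) 1 + d) z := fun z => by
      have := (binomCon I).add ((binomCon I).refl z) hinv
      rwa [add_zero, add_comm d, ← add_assoc] at this
    exact (binomCon I).trans ((binomCon I).symm (key x))
      ((binomCon I).trans ((binomCon I).add h ((binomCon I).refl d)) (key y))
  · push Not at hj
    have hb : blockCon I j (x + Finsupp.single (j, i) 1) (y + Finsupp.single (j, i) 1) := by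
      refine con_of_binom_mem_generalizedCodeIdeal (c := blockCon I j) (fun a b hab => ⟨?_, ?_⟩) h
      · have hj' : a j = b j := sub_eq_zero.1 (hj _ hab)
        ext ⟨j', i'⟩
        rw [Finsupp.filter_apply, Finsupp.filter_apply]
        by_cases h : j' = j
        · subst h
          rw [if_pos rfl, if_pos rfl, crossing_apply, crossing_apply, hj']
        · rw [if_neg h, if_neg h]
      · rw [filter_crossing, filter_crossing]
        refine binom_crossing_mem ?_
        convert hab using 1
        ext j'
        by_cases h : j' = j
        · subst h
          simpa using (hj _ hab).symm
        · simp [h]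
    obtain ⟨h1, h2⟩ := hb
    simp only [Finsupp.filter_add] at h1 h2
    rw [Finsupp.filter_single_of_neg _ (by simp), add_zero, add_zero] at h2
    have h1' := add_right_cancel h1
    have := (binomCon I).add ((binomCon I).refl (x.filter fun k => k.1 = j)) h2
    nth_rw 2 [h1'] at this
    rwa [Finsupp.filter_add_filter_not, Finsupp.filter_add_filter_not] at this

end CodeIdeal

/-! ### The counterexample -/

section Example

variable {K : Type v} [Field K]

/-- Exponents are equal, or both have the same total degree, which is at least two. -/
def degreeCon (σ : Type u) : AddCon (σ →₀ ℕ) where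
  r x y := x = y ∨ x.degree = y.degree ∧ 2 ≤ x.degree
  iseqv :=
    { refl := fun x => Or.inl rfl
      symm := fun h => h.elim (fun h => Or.inl h.symm) fun h => Or.inr ⟨h.1.symm, h.1 ▸ h.2⟩
      trans := by
        rintro x y z (rfl | h) (rfl | h')
        · exact Or.inl rfl
        · exact Or.inr h'
        · exact Or.inr h
        · exact Or.inr ⟨h.1.trans h'.1, h.2⟩ }
  add' := by
    rintro x y z t (rfl | h) (rfl | h')
    · exact Or.inl rfl
    all_goals
      right
      simp only [map_add]
      omega

theorem exampleIdeal_eq_span (K : Type v) [Field K] : exampleIdeal K =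
    Ideal.span {f | ∃ a b : Fin 2 →₀ ℕ,
      ((a = Finsupp.single 0 2 ∨ a = Finsupp.single 1 2) ∧
        b = Finsupp.single 0 1 + Finsupp.single 1 1) ∧ f = binom K a b} := by
  have h0 : (X 0 ^ 2 - X 0 * X 1 : MvPolynomial (Fin 2) K) =
      binom K (Finsupp.single 0 2) (Finsupp.single 0 1 + Finsupp.single 1 1) := by
    rw [binom, X_pow_eq_monomial, X, X, monomial_mul, one_mul]
  have h1 : (X 1 ^ 2 - X 0 * X 1 : MvPolynomial (Fin 2) K) =
      binom K (Finsupp.single 1 2) (Finsupp.single 0 1 + Finsupp.single 1 1) := by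
    rw [binom, X_pow_eq_monomial, X, X, monomial_mul, one_mul]
  rw [exampleIdeal, h0, h1]
  congr 1
  ext f
  constructor
  · rintro (rfl | rfl)
    · exact ⟨_, _, ⟨Or.inl rfl, rfl⟩, rfl⟩
    · exact ⟨_, _, ⟨Or.inr rfl, rfl⟩, rfl⟩
  · rintro ⟨a, b, ⟨rfl | rfl, rfl⟩, rfl⟩
    · exact Or.inl rfl
    · exact Or.inr rfl

theorem isBinomialIdeal_exampleIdeal : IsBinomialIdeal (exampleIdeal K) :=
  ⟨_, exampleIdeal_eq_span K⟩

theorem binom_sq_mul_mem_exampleIdeal (i : Fin 2) :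
    binom K (Finsupp.single i 2) (Finsupp.single 0 1 + Finsupp.single 1 1) ∈ exampleIdeal K := by
  rw [exampleIdeal_eq_span]
  fin_cases i
  · exact Ideal.subset_span ⟨_, _, ⟨Or.inl rfl, rfl⟩, rfl⟩
  · exact Ideal.subset_span ⟨_, _, ⟨Or.inr rfl, rfl⟩, rfl⟩

/-- Both generators relate monomials of degree two. In particular, monomials of degree below two are
alone in their classes. -/
theorem degreeCon_of_binom_mem_exampleIdeal {x y : Fin 2 →₀ ℕ} (h : binom K x y ∈ exampleIdeal K) :
    degreeCon (Fin 2) x y := by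
  rw [exampleIdeal_eq_span] at h
  refine con_of_binom_mem_span ?_ h
  rintro _ _ ⟨rfl | rfl, rfl⟩ <;> exact Or.inr (by simp)

/-- In the lexicographic order with `x > y`, `y²` is the smallest monomial of degree two. -/
theorem liesInWithLeading_exampleIdeal : LiesInWithLeading (exampleIdeal K)
    (Finsupp.single 0 1 + Finsupp.single 1 1) (Finsupp.single 1 2) := by
  refine isBinomialIdeal_exampleIdeal.liesInWithLeading (m := MonomialOrder.lex)
    ((binomCon _).symm (binom_sq_mul_mem_exampleIdeal 1)) ?_ ?_ ?_
  · rw [MonomialOrder.lex_lt_iff]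
    exact ⟨0, by simp, by simp⟩
  · rintro ⟨y, hy, hlt⟩
    rcases degreeCon_of_binom_mem_exampleIdeal hy with rfl | ⟨hdeg, -⟩
    · exact lt_irrefl _ hlt
    rw [MonomialOrder.lex_lt_iff] at hlt
    obtain ⟨i, hi, hlt⟩ := hlt
    rw [Finsupp.degree_eq_sum, Finsupp.degree_eq_sum, Fin.sum_univ_two, Fin.sum_univ_two] at hdeg
    fin_cases i
    · simp at hlt
    · have h0 : y 0 = 0 := by simpa using hi 0 (by simp)
      simp [h0] at hdeg hlt
      omega
  · rintro d hd ⟨y, hy, hlt⟩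
    have hdeg : d.degree < 2 := by
      obtain ⟨e, he⟩ := exists_add_of_le hd.le
      have h2 := congrArg Finsupp.degree he
      have he0 : e.degree ≠ 0 := fun h => hd.ne (by
        rw [he, (Finsupp.degree_eq_zero_iff e).1 h, add_zero])
      simp only [map_add, Finsupp.degree_single] at h2
      omega
    rcases degreeCon_of_binom_mem_exampleIdeal hy with rfl | ⟨-, h⟩
    · exact lt_irrefl _ hlt
    · omega

theorem MonomialOrder.sq_lt_mul {σ : Type u} (m : MonomialOrder.{u, u} σ) {i j : σ}
    (h : Finsupp.single i 1 ≺[m] Finsupp.single j 1) :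
    Finsupp.single i 2 ≺[m] Finsupp.single i 1 + Finsupp.single j 1 := by
  rw [show (2 : ℕ) = 1 + 1 from rfl, Finsupp.single_add, map_add, map_add]
  exact add_lt_add_of_le_of_lt le_rfl h

/-- The trailing monomial `xy` would have to be standard, but the square of the smaller variable
lies below it; the two variables are never tied. -/
theorem not_liesInWithLeading_exampleIdeal : ¬ LiesInWithLeading (exampleIdeal K)
    (Finsupp.single 1 2) (Finsupp.single 0 1 + Finsupp.single 1 1) := by
  rintro ⟨m, G, hG, hmem, hlt⟩
  refine hG.not_isNonstandard_right hmem hlt ?_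
  have hmem' := fun i => (binomCon _).symm (binom_sq_mul_mem_exampleIdeal (K := K) i)
  rcases lt_trichotomy (m.toSyn (Finsupp.single 0 1)) (m.toSyn (Finsupp.single 1 1)) with h | h | h
  · exact ⟨_, hmem' 0, m.sq_lt_mul h⟩
  · exact absurd (m.toSyn.injective h) (by simp [Finsupp.single_left_inj])
  · refine ⟨_, hmem' 1, ?_⟩
    rw [add_comm (Finsupp.single 0 1)]
    exact m.sq_lt_mul h

end Example

theorem mainTheorem4 (K : Type v) [Field K] :
    (∀ (F : Type w) [Field F] [Fintype F] (α : Fˣ), (∀ x : Fˣ, x ∈ Subgroup.zpowers α) →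
      ∀ (n : ℕ) (C : Submodule F (Fin n → F)) (a b : (Fin n × Fin (Fintype.card F - 1)) →₀ ℕ),
        a ≠ 0 → b ≠ 0 →
        (binom K a b ∈ universalGroebnerBasis (generalizedCodeIdeal K α C) →
          binom K b a ∈ universalGroebnerBasis (generalizedCodeIdeal K α C)) ∧
        (LiesInWithLeading (generalizedCodeIdeal K α C) a b →
          LiesInWithLeading (generalizedCodeIdeal K α C) b a)) ∧
    (LiesInWithLeading (exampleIdeal K)
        (Finsupp.single 0 1 + Finsupp.single 1 1) (Finsupp.single 1 2) ∧
      ¬ LiesInWithLeading (exampleIdeal K)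
        (Finsupp.single 1 2) (Finsupp.single 0 1 + Finsupp.single 1 1)) ∧
    ((2 : K) ≠ 0 →
      binom K (Finsupp.single 0 1 + Finsupp.single 1 1) (Finsupp.single 1 2) ∈
          universalGroebnerBasis (exampleIdeal K) ∧
        binom K (Finsupp.single 1 2) (Finsupp.single 0 1 + Finsupp.single 1 1) ∉
          universalGroebnerBasis (exampleIdeal K)) := by
  refine ⟨fun F _ _ α _ n C a b _ hb => ?_,
    ⟨liesInWithLeading_exampleIdeal, not_liesInWithLeading_exampleIdeal⟩,
    fun h2 => ⟨liesInWithLeading_exampleIdeal.mem_universalGroebnerBasis, fun h => ?_⟩⟩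
  · have hsymm : LiesInWithLeading (generalizedCodeIdeal K α C) a b →
        LiesInWithLeading (generalizedCodeIdeal K α C) b a :=
      LiesInWithLeading.symm_of_isCancellative isBinomialIdeal_generalizedCodeIdeal
        isCancellative_generalizedCodeIdeal hb
    refine ⟨fun h => ?_, hsymm⟩
    rcases liesInWithLeading_or_two_eq_zero h with h' | h2
    · exact (hsymm h').mem_universalGroebnerBasis
    · rwa [binom_comm_of_two_eq_zero h2]
  · exact (liesInWithLeading_or_two_eq_zero h).elim not_liesInWithLeading_exampleIdeal h2
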